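/- Let $k$ be a field of characteristic $0$, let $n\ge 0$ be an integer, and let $\alpha=(\alpha_1,\dots,\alpha_m)$ be a composition of $n$ (a tuple of positive integers with sum $n$). Let $S_n$ be the group of permutations of $[n]=\{1,\dots,n\}$ (with $(uv)(i)=u(v(i))$), and let $w_0\in S_n$ be the permutation $w_0(i)=n+1-i$. In the group algebra $k[S_n]$ set $$B_\alpha=\sum_{\substack{w\in S_n\\ \operatorname{Des} w\subseteq\{\alpha_1+\cdots+\alpha_j\,:\,1\le j\le m-1\}}} w,\qquad \operatorname{Des} w=\{i\in[n-1]: w(i)>w(i+1)\}.$$ A set composition of $[n]$ is a tuple $F=(F_1,\dots,F_r)$ of nonempty, pairwise disjoint sets with union $[n]$; its length is $\ell(F)=r$ and its type is the composition $(|F_1|,\dots,|F_r|)$ of $n$. Let $n_\alpha(F)$ be the number of set compositions $G$ of $[n]$ of type $\alpha$ such that every block of $F$ is a subset of some block of $G$, and let $\widetilde n_\alpha(F)=(-1)^{n-\ell(F)}n_\alpha(F)\in\mathbb Z$. Then the minimal polynomial of the element $w_0B_\alpha$ of $k[S_n]$ over $k$ is $$\mu(w_0B_\alpha)=\prod_{\kappa}(x-\kappa)\in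 k[x],$$ where $\kappa$ ranges over the distinct integers in the set $\{\widetilde n_\alpha(F): F\text{ a set composition of }[n]\}$. Hence $w_0B_\alpha$ and $B_\alpha w_0$ are diagonalizable: left multiplication and right multiplication by each of these two elements are diagonalizable $k$-linear endomorphisms of $k[S_n]$. -/

import Mathlib

open Polynomial

/-- A set composition of `{1, …, n}` (modelled as `Fin n`), also called a face: an ordered tuple of
nonempty, pairwise disjoint sets whose union is the whole set. -/
@[ext]
structure SetComposition (n : ℕ) where
  /-- The blocks, in order. -/
  blocks : List (Finset (Fin n))
  nonempty_of_mem : ∀ B ∈ blocks, B.Nonempty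
  pairwise_disjoint : blocks.Pairwise Disjoint
  cover : ∀ x : Fin n, ∃ B ∈ blocks, x ∈ B

namespace SetComposition

variable {n : ℕ}

/-- The number of blocks. -/
def length (F : SetComposition n) : ℕ := F.blocks.length

theorem nodup_blocks (F : SetComposition n) : F.blocks.Nodup := by
  refine F.pairwise_disjoint.imp_of_mem ?_
  intro A B hA _ hAB hEq
  subst hEq
  exact (F.nonempty_of_mem A hA).ne_empty (disjoint_self.mp hAB)

instance : Finite (SetComposition n) :=
  Finite.of_injective
    (fun F : SetComposition n => (⟨F.blocks, F.nodup_blocks⟩ : {l : List (Finset (Fin n)) // l.Nodup}))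
    (fun F G h => by
      ext1
      exact congrArg Subtype.val h)

noncomputable instance : Fintype (SetComposition n) := Fintype.ofFinite _

theorem sum_card_blocks (F : SetComposition n) : (F.blocks.map Finset.card).sum = n := by
  have h1 : (F.blocks.map Finset.card).sum = ∑ B ∈ F.blocks.toFinset, B.card :=
    (List.sum_toFinset Finset.card F.nodup_blocks).symm
  have hpd : (F.blocks.toFinset : Set (Finset (Fin n))).PairwiseDisjoint id := by
    intro A hA B hB hAB
    rw [Finset.mem_coe, List.mem_toFinset] at hA hB
    exact F.pairwise_disjoint.forall hA hB hAB
  have h2 : F.blocks.toFinset.biUnion id = Finset.univ := by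
    ext x
    simpa using F.cover x
  have h3 := Finset.card_biUnion hpd
  rw [h2] at h3
  rw [h1]
  simpa using h3.symm

/-- The type of a set composition: the composition of `n` formed by the sizes of its blocks. -/
def type (F : SetComposition n) : Composition n where
  blocks := F.blocks.map Finset.card
  blocks_pos := by
    intro i hi
    obtain ⟨B, hB, rfl⟩ := List.mem_map.mp hi
    exact (F.nonempty_of_mem B hB).card_pos
  blocks_sum := F.sum_card_blocks

/-- `F` is contained in `G` if every block of `F` is a subset of some block of `G`. -/
def IsContained (F G : SetComposition n) : Prop :=
  ∀ A ∈ F.blocks, ∃ B ∈ G.blocks, A ⊆ B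

/-- The knapsack number `n_α(F)`: the number of set compositions `G` of type `α` in which `F` is
contained. -/
noncomputable def knapsackNumber (α : Composition n) (F : SetComposition n) : ℕ :=
  Set.ncard {G : SetComposition n | F.IsContained G ∧ G.type = α}

/-- The signed knapsack number `(-1)^(n - ℓ(F)) n_α(F)`; note that `ℓ(F) ≤ n`. -/
noncomputable def signedKnapsackNumber (α : Composition n) (F : SetComposition n) : ℤ :=
  (-1) ^ (n - F.length) * (knapsackNumber α F : ℤ)

/-- The finite set of all distinct signed knapsack numbers with respect to `α`. -/
noncomputable def signedKnapsackSet (α : Composition n) : Finset ℤ :=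
  Finset.univ.image (signedKnapsackNumber α)

end SetComposition

namespace DescentAlgebra

variable {n : ℕ}

/-- The descent set of `w`, as a set of positions in `{1, …, n - 1}`. As `Fin n` is `{0, …, n - 1}`,
position `i + 1` is a descent when the values of `w` at the indices `i`, `i + 1` decrease. -/
def descentSet (w : Equiv.Perm (Fin n)) : Finset ℕ :=
  (Finset.univ.filter fun i : Fin (n - 1) =>
    w ⟨(i : ℕ) + 1, by omega⟩ < w ⟨(i : ℕ), by omega⟩).image fun i : Fin (n - 1) => (i : ℕ) + 1

/-- The subset `{α₁, α₁ + α₂, …, α₁ + ⋯ + α_{ℓ-1}}` of `{1, …, n - 1}` whose sequence of gaps (between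
`0`, its elements, and `n`) is the composition `α` of `n`. -/
def gapsInv (α : Composition n) : Finset ℕ :=
  (Finset.Ioo 0 α.length).image α.sizeUpTo

/-- `B_I`: the sum of all permutations whose descent set is contained in `I`. -/
noncomputable def BSet (k : Type*) [Field k] (n : ℕ) (I : Finset ℕ) :
    MonoidAlgebra k (Equiv.Perm (Fin n)) :=
  ∑ w ∈ Finset.univ.filter (fun w : Equiv.Perm (Fin n) => descentSet w ⊆ I), MonoidAlgebra.of k _ w

/-- `B_α`. -/
noncomputable def B (k : Type*) [Field k] (α : Composition n) :
    MonoidAlgebra k (Equiv.Perm (Fin n)) :=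
  BSet k n (gapsInv α)

/-- The element `w₀` of the group algebra: the order-reversing permutation. -/
noncomputable def w₀ (k : Type*) [Field k] (n : ℕ) : MonoidAlgebra k (Equiv.Perm (Fin n)) :=
  MonoidAlgebra.of k _ (Fin.revPerm : Equiv.Perm (Fin n))

end DescentAlgebra

/-- An endomorphism of a vector space is diagonalizable if there is a basis of eigenvectors. -/
def IsDiagonalizable {k : Type*} {V : Type*} [Field k] [AddCommGroup V] [Module k V]
    (f : V →ₗ[k] V) : Prop :=
  ∃ (s : Set V) (b : Module.Basis s k V), ∀ i : s, ∃ c : k, f (b i) = c • b i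

/-! Weak orders on `Fin n` (equivalently, set compositions) are the faces of the braid arrangement;
under the Tits product they form a monoid in which the chambers, one per permutation, span a left
ideal. Write b for the sum of the faces of type α (`faceSum`) and s for the sum of all faces F with
sign (-1)^(n - ℓ(F)) (`signSum`). On chambers, left multiplication by b is right multiplication by
B_α, and by inclusion-exclusion over descent sets left multiplication by s is right multiplication
by w₀. The chamber representation is faithful (`eq_zero_of_mul_chamber`), so w₀B_α and x = bs
satisfy the same polynomials (`aeval_eq_zero_iff`), and s² = 1 because w₀² = 1.

Each face G gives a character of the face algebra, equal to 1 on the faces F with GF = G and to 0 on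
the others. It sends b to n_α(G) and s to (-1)^(n - ℓ(G)), so every signed knapsack number is a root
of the minimal polynomial. Conversely, let p be the product of X - κ over these numbers. All
characters vanish on p(x), so p(x) is nilpotent (`isNilpotent_of_supportChar`) and the minimal
polynomial divides a power of p.

It remains to see that the minimal polynomial is squarefree. Filter the algebra by n_α(G) ≥ t. Right
multiplication by b acts as the scalar t on the t-th layer: if n_α(G) = t, exactly t faces F of type
α fix G, and every other one has n_α(GF) > t. As s² = 1, right multiplication by x² acts there as
t², while x acts as 0 on layer 0. Hence X ∏ (X - t)(X + t), over 1 ≤ t ≤ m with m large, annihilates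
x, and in characteristic 0 it is squarefree. -/

/-! ### Weak orders and the Tits product -/

/-- A total preorder on `Fin n`. These are the faces of the braid arrangement. -/
@[ext]
structure WeakOrder (n : ℕ) where
  /-- The underlying relation. -/
  le : Fin n → Fin n → Prop
  total : ∀ a b, le a b ∨ le b a
  trans : ∀ {a b c}, le a b → le b c → le a c

namespace WeakOrder

variable {n : ℕ}

theorem refl (F : WeakOrder n) (a : Fin n) : F.le a a := (F.total a a).elim id id

theorem le_of_not_le (F : WeakOrder n) {a b : Fin n} (h : ¬ F.le a b) : F.le b a :=
  (F.total a b).resolve_left h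

theorem le_injective : Function.Injective (WeakOrder.le : WeakOrder n → _) :=
  fun _ _ h => WeakOrder.ext h

instance : Finite (WeakOrder n) := Finite.of_injective _ le_injective

noncomputable instance : Fintype (WeakOrder n) := Fintype.ofFinite _

/-- The Tits product: order by `F` and break ties by `G`. -/
instance : Monoid (WeakOrder n) where
  mul F G :=
    { le := fun a b => F.le a b ∧ (F.le b a → G.le a b)
      total := fun a b => by
        have := F.total a b
        have := G.total a b
        tauto
      trans := fun {a b c} h₁ h₂ => ⟨F.trans h₁.1 h₂.1, fun h =>
        G.trans (h₁.2 (F.trans h₂.1 h)) (h₂.2 (F.trans h h₁.1))⟩ }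
  one := { le := fun _ _ => True, total := fun _ _ => Or.inl trivial, trans := fun _ _ => trivial }
  mul_assoc F G H := by
    ext a b
    change (F.le a b ∧ (F.le b a → G.le a b)) ∧ ((F.le b a ∧ (F.le a b → G.le b a)) → H.le a b) ↔
      F.le a b ∧ (F.le b a → G.le a b ∧ (G.le b a → H.le a b))
    tauto
  one_mul F := by
    ext a b
    change True ∧ (True → F.le a b) ↔ F.le a b
    tauto
  mul_one F := by
    ext a b
    change F.le a b ∧ (F.le b a → True) ↔ F.le a b
    tauto

theorem mul_le {F G : WeakOrder n} {a b : Fin n} :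
    (F * G).le a b ↔ F.le a b ∧ (F.le b a → G.le a b) := Iff.rfl

/-- The weak order pulled back along a map. -/
def comap {m : ℕ} (g : Fin m → Fin n) (F : WeakOrder n) : WeakOrder m where
  le a b := F.le (g a) (g b)
  total _ _ := F.total _ _
  trans := F.trans

/-- The weak order induced by a function to a linear order. -/
def ofFun {β : Type*} [LinearOrder β] (h : Fin n → β) : WeakOrder n where
  le a b := h a ≤ h b
  total _ _ := le_total _ _
  trans := le_trans

/-- The opposite weak order. -/
def opposite (F : WeakOrder n) : WeakOrder n where
  le a b := F.le b a
  total _ _ := F.total _ _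
  trans h₁ h₂ := F.trans h₂ h₁

open Classical in
/-- The number of elements weakly below `b`. -/
noncomputable def rank (F : WeakOrder n) (b : Fin n) : ℕ :=
  (Finset.univ.filter fun c => F.le c b).card

theorem le_iff_rank_le (F : WeakOrder n) (a b : Fin n) : F.le a b ↔ F.rank a ≤ F.rank b := by
  constructor
  · intro h
    refine Finset.card_le_card fun c hc => ?_
    simp only [Finset.mem_filter, Finset.mem_univ, true_and] at hc ⊢
    exact F.trans hc h
  · intro h
    by_contra hn
    refine absurd h (not_le.mpr (Finset.card_lt_card ?_))
    rw [Finset.ssubset_iff_of_subset]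
    · exact ⟨a, by simpa using F.refl a, by simpa using hn⟩
    · intro c hc
      simp only [Finset.mem_filter, Finset.mem_univ, true_and] at hc ⊢
      exact F.trans hc (F.le_of_not_le hn)

theorem rank_pos (F : WeakOrder n) (b : Fin n) : 0 < F.rank b :=
  Finset.card_pos.mpr ⟨b, by simpa using F.refl b⟩

theorem rank_le (F : WeakOrder n) (b : Fin n) : F.rank b ≤ n :=
  (Finset.card_le_univ _).trans (by simp)

theorem rank_eq_iff (F : WeakOrder n) (b : Fin n) : F.rank b = n ↔ ∀ c, F.le c b := by
  classical
  have h := Finset.card_eq_iff_eq_univ (Finset.univ.filter fun c => F.le c b)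
  rw [Fintype.card_fin] at h
  have e : F.rank b = (Finset.univ.filter fun c => F.le c b).card := by
    unfold rank; congr
  rw [e, h, Finset.filter_eq_self]
  simp

/-- The sizes of the proper nonempty lower sets. -/
noncomputable def sizes (F : WeakOrder n) : Finset ℕ := (Finset.univ.image F.rank).erase n

/-- The number of classes of tied elements. -/
noncomputable def length (F : WeakOrder n) : ℕ := (Finset.univ.image F.rank).card

theorem card_image_eq_of_eq_iff {ι β γ : Type*} [DecidableEq β] [DecidableEq γ] (s : Finset ι)
    (f : ι → β) (g : ι → γ) (h : ∀ a b, f a = f b ↔ g a = g b) :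
    (s.image f).card = (s.image g).card := by
  refine Finset.card_bij' (fun x hx => g (Finset.mem_image.mp hx).choose)
    (fun y hy => f (Finset.mem_image.mp hy).choose) ?_ ?_ ?_ ?_
  · exact fun x hx => Finset.mem_image_of_mem _ (Finset.mem_image.mp hx).choose_spec.1
  · exact fun x hx => Finset.mem_image_of_mem _ (Finset.mem_image.mp hx).choose_spec.1
  · intro x hx
    have p := Finset.mem_image.mp hx
    have q := Finset.mem_image.mp (Finset.mem_image_of_mem g p.choose_spec.1)
    exact ((h _ _).mpr q.choose_spec.2).trans p.choose_spec.2
  · intro x hx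
    have p := Finset.mem_image.mp hx
    have q := Finset.mem_image.mp (Finset.mem_image_of_mem f p.choose_spec.1)
    exact ((h _ _).mp q.choose_spec.2).trans p.choose_spec.2

theorem length_eq_card_image {β : Type*} [LinearOrder β] (F : WeakOrder n) (h : Fin n → β)
    (hh : ∀ a b, F.le a b ↔ h a ≤ h b) : F.length = (Finset.univ.image h).card :=
  card_image_eq_of_eq_iff _ _ _ fun a b => by
    rw [le_antisymm_iff, le_antisymm_iff, ← hh, ← hh, ← le_iff_rank_le, ← le_iff_rank_le]

theorem length_le (F : WeakOrder n) : F.length ≤ n :=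
  Finset.card_image_le.trans (by simp)

theorem length_comap {m : ℕ} (g : Fin m → Fin n) (hg : Function.Surjective g) (F : WeakOrder n) :
    (F.comap g).length = F.length := by
  rw [length_eq_card_image (F.comap g) (F.rank ∘ g) fun a b => F.le_iff_rank_le _ _, length,
    ← Finset.image_image, Finset.image_univ_of_surjective hg]

theorem sizes_subset (F : WeakOrder n) : F.sizes ⊆ Finset.Ioo 0 n := by
  intro i hi
  obtain ⟨hne, hi⟩ := Finset.mem_erase.mp hi
  obtain ⟨b, -, rfl⟩ := Finset.mem_image.mp hi
  exact Finset.mem_Ioo.mpr ⟨F.rank_pos b, lt_of_le_of_ne (F.rank_le b) hne⟩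

/-- For positive n the top class has rank n, so erasing n from the ranks loses exactly one value. -/
theorem sub_length_eq (F : WeakOrder n) : n - F.length = (n - 1) - F.sizes.card := by
  rcases Nat.eq_zero_or_pos n with rfl | hn
  · simp
  · have : n ∈ Finset.univ.image F.rank := by
      have : Nonempty (Fin n) := ⟨⟨0, hn⟩⟩
      obtain ⟨b, -, hb⟩ := Finset.exists_max_image Finset.univ F.rank Finset.univ_nonempty
      refine Finset.mem_image.mpr ⟨b, Finset.mem_univ _, (F.rank_eq_iff b).mpr fun c => ?_⟩
      exact (F.le_iff_rank_le _ _).mpr (hb c (Finset.mem_univ _))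
    rw [sizes, Finset.card_erase_of_mem this, length]
    have := Finset.card_pos.mpr ⟨_, this⟩
    omega

/-! ### Chambers and the faces below them -/

/-- The weak order listing the elements as `σ 0, σ 1, …`. -/
def chamber (σ : Equiv.Perm (Fin n)) : WeakOrder n := ofFun σ.symm

theorem chamber_le {σ : Equiv.Perm (Fin n)} {a b : Fin n} :
    (chamber σ).le a b ↔ σ.symm a ≤ σ.symm b := Iff.rfl

theorem mem_iff_lt_card (L : Finset (Fin n)) (hL : ∀ i j, i ≤ j → j ∈ L → i ∈ L) (i : Fin n) :
    i ∈ L ↔ (i : ℕ) < L.card := by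
  constructor
  · intro hi
    have : Finset.Iic i ⊆ L := fun j hj => hL j i (Finset.mem_Iic.mp hj) hi
    have := Finset.card_le_card this
    rw [Fin.card_Iic] at this
    omega
  · intro hi
    by_contra hn
    have : L ⊆ Finset.Iio i := fun j hj => Finset.mem_Iio.mpr (lt_of_not_ge fun h => hn (hL i j h hj))
    have := Finset.card_le_card this
    rw [Fin.card_Iio] at this
    omega

/-- Lower sets of a face below the chamber of `τ` are initial segments of the list `τ`, hence
determined by their size. -/
theorem le_iff_lt_rank {F : WeakOrder n} {τ : Equiv.Perm (Fin n)}
    (h : ∀ a b, (chamber τ).le a b → F.le a b) (c b : Fin n) :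
    F.le c b ↔ (τ.symm c : ℕ) < F.rank b := by
  classical
  have key := mem_iff_lt_card ((Finset.univ.filter fun c => F.le c b).map τ.symm.toEmbedding)
    (fun i j hij hj => by
      simp only [Finset.mem_map_equiv, Equiv.symm_symm, Finset.mem_filter, Finset.mem_univ,
        true_and] at hj ⊢
      exact F.trans (h _ _ (by simpa [chamber_le] using hij)) hj) (τ.symm c)
  rw [Finset.card_map] at key
  simp only [Finset.mem_map_equiv, Equiv.symm_symm, Finset.mem_filter, Finset.mem_univ,
    true_and, Equiv.apply_symm_apply] at key
  rw [key, rank]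

theorem rank_eq_of_le_iff_lt {F : WeakOrder n} {τ : Equiv.Perm (Fin n)} {b : Fin n} {r : ℕ}
    (hr : r ≤ n) (h : ∀ c, F.le c b ↔ (τ.symm c : ℕ) < r) : F.rank b = r := by
  classical
  have : (Finset.univ.filter fun c => F.le c b) =
      (Finset.univ.filter fun i : Fin n => (i : ℕ) < r).map τ.toEmbedding := by
    ext c
    simp [h, Finset.mem_map_equiv]
  rw [rank, this, Finset.card_map, Fin.card_filter_val_lt, min_eq_right hr]

theorem exists_eq_chamber (F : WeakOrder n) (h : ∀ a b, F.le a b → F.le b a → a = b) :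
    ∃ τ : Equiv.Perm (Fin n), F = chamber τ := by
  have hlt : ∀ a, F.rank a - 1 < n := fun a => by
    have := F.rank_pos a
    have := F.rank_le a
    omega
  have hinj : Function.Injective fun a => (⟨F.rank a - 1, hlt a⟩ : Fin n) := by
    intro a b hab
    have hab : F.rank a - 1 = F.rank b - 1 := congrArg Fin.val hab
    have := F.rank_pos a
    have := F.rank_pos b
    exact h a b ((F.le_iff_rank_le a b).mpr (by omega)) ((F.le_iff_rank_le b a).mpr (by omega))
  refine ⟨(Equiv.ofBijective _ (Finite.injective_iff_bijective.mp hinj)).symm, ?_⟩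
  ext a b
  rw [chamber_le, Equiv.symm_symm, F.le_iff_rank_le, Equiv.ofBijective_apply,
    Equiv.ofBijective_apply, Fin.mk_le_mk]
  have := F.rank_pos a
  have := F.rank_pos b
  omega

theorem exists_mul_chamber (F : WeakOrder n) (σ : Equiv.Perm (Fin n)) :
    ∃ τ : Equiv.Perm (Fin n), F * chamber σ = chamber τ := by
  refine exists_eq_chamber _ fun a b hab hba => ?_
  rw [mul_le, chamber_le] at hab hba
  exact σ.symm.injective (le_antisymm (hab.2 hba.1) (hba.2 hab.1))

theorem chamber_injective : Function.Injective (chamber : Equiv.Perm (Fin n) → WeakOrder n) := by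
  intro σ τ h
  have h' : ∀ a b, σ.symm a ≤ σ.symm b ↔ τ.symm a ≤ τ.symm b := fun a b => by
    rw [← chamber_le, h, chamber_le]
  have hm : StrictMono (τ.symm ∘ σ) := Monotone.strictMono_of_injective
    (fun a b hab => (h' _ _).mp (by simpa using hab)) (τ.symm.injective.comp σ.injective)
  have : τ.symm ∘ σ = id := by
    have e := Subsingleton.elim (hm.orderIsoOfSurjective _ (τ.symm.surjective.comp σ.surjective))
      (OrderIso.refl (Fin n))
    funext x
    exact congrArg (fun f : Fin n ≃o Fin n => f x) e
  ext x
  have := congrFun this x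
  simp only [Function.comp_apply, id, Equiv.symm_apply_eq] at this
  rw [this]

/-- The weak order obtained by cutting the list `σ 0, σ 1, …` after its first `i` entries, for each
`i ∈ I`. -/
def cutFace (σ : Equiv.Perm (Fin n)) (I : Finset ℕ) : WeakOrder n where
  le a b := ∀ i ∈ I, (σ.symm b : ℕ) < i → (σ.symm a : ℕ) < i
  total a b := by
    rcases le_total (σ.symm a) (σ.symm b) with h | h
    · exact Or.inl fun i _ hi => lt_of_le_of_lt h hi
    · exact Or.inr fun i _ hi => lt_of_le_of_lt h hi
  trans h₁ h₂ i hi h := h₁ i hi (h₂ i hi h)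

theorem cutFace_le {σ : Equiv.Perm (Fin n)} {I : Finset ℕ} {a b : Fin n} :
    (cutFace σ I).le a b ↔ ∀ i ∈ I, (σ.symm b : ℕ) < i → (σ.symm a : ℕ) < i := Iff.rfl

theorem eq_cutFace {F : WeakOrder n} {τ : Equiv.Perm (Fin n)}
    (h : ∀ a b, (chamber τ).le a b → F.le a b) : F = cutFace τ F.sizes := by
  ext a b
  constructor
  · intro hab i hi hb
    obtain ⟨-, hi⟩ := Finset.mem_erase.mp hi
    obtain ⟨c, -, rfl⟩ := Finset.mem_image.mp hi
    exact (le_iff_lt_rank h a c).mp (F.trans hab ((le_iff_lt_rank h b c).mpr hb))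
  · intro hab
    by_cases hb : F.rank b = n
    · exact (F.rank_eq_iff b).mp hb a
    · exact (le_iff_lt_rank h a b).mpr (hab _ (Finset.mem_erase.mpr
        ⟨hb, Finset.mem_image_of_mem _ (Finset.mem_univ _)⟩) ((le_iff_lt_rank h b b).mp (F.refl b)))

theorem sizes_cutFace (τ : Equiv.Perm (Fin n)) {I : Finset ℕ} (hI : I ⊆ Finset.Ioo 0 n) :
    (cutFace τ I).sizes = I := by
  ext i
  constructor
  · intro hi
    obtain ⟨hne, hi⟩ := Finset.mem_erase.mp hi
    obtain ⟨b, -, rfl⟩ := Finset.mem_image.mp hi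
    by_contra hnI
    by_cases hex : ∃ i ∈ I, (τ.symm b : ℕ) < i
    -- The first cut after the position of `b` ends the block of `b`, so it equals the rank of `b`.
    · obtain ⟨i, hi, hmin⟩ := Finset.exists_min_image (I.filter fun i => (τ.symm b : ℕ) < i) id
        (by obtain ⟨i, hi⟩ := hex; exact ⟨i, Finset.mem_filter.mpr hi⟩)
      rw [Finset.mem_filter] at hi
      refine hnI ?_
      rw [rank_eq_of_le_iff_lt (τ := τ) (r := i) (Finset.mem_Ioo.mp (hI hi.1)).2.le fun c => ?_]
      · exact hi.1
      · refine ⟨fun h => h i hi.1 hi.2, fun h j hj hbj => lt_of_lt_of_le h ?_⟩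
        exact hmin j (Finset.mem_filter.mpr ⟨hj, hbj⟩)
    · push Not at hex
      exact hne ((rank_eq_iff _ _).mpr fun c i hi h => absurd h (not_lt.mpr (hex i hi)))
  · intro hi
    obtain ⟨h0, hn⟩ := Finset.mem_Ioo.mp (hI hi)
    -- The last entry before the cut `i` has rank `i`.
    refine Finset.mem_erase.mpr ⟨hn.ne, Finset.mem_image.mpr ⟨τ ⟨i - 1, by omega⟩,
      Finset.mem_univ _, rank_eq_of_le_iff_lt (τ := τ) hn.le fun c => ?_⟩⟩
    rw [cutFace_le, Equiv.symm_apply_apply]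
    refine ⟨fun h => h i hi (by simp; omega), fun h j hj hij => ?_⟩
    simp only at hij
    omega

end WeakOrder

/-! ### Descent sets of permutations -/

namespace DescentAlgebra

variable {n : ℕ}

theorem mem_descentSet {w : Equiv.Perm (Fin n)} {j : ℕ} :
    j ∈ descentSet w ↔ ∃ p q : Fin n, (p : ℕ) + 1 = q ∧ j = q ∧ w q < w p := by
  simp only [descentSet, Finset.mem_image, Finset.mem_filter, Finset.mem_univ, true_and]
  constructor
  · rintro ⟨i, hi, rfl⟩
    exact ⟨_, _, rfl, rfl, hi⟩
  · rintro ⟨p, q, h, rfl, hlt⟩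
    refine ⟨⟨p, by omega⟩, ?_, h⟩
    convert hlt using 2
    exact Fin.ext h

theorem descentSet_subset (w : Equiv.Perm (Fin n)) : descentSet w ⊆ Finset.Ioo 0 n := by
  intro j hj
  obtain ⟨p, q, h, rfl, -⟩ := mem_descentSet.mp hj
  exact Finset.mem_Ioo.mpr ⟨by omega, q.2⟩

theorem lt_of_no_descent (w : Equiv.Perm (Fin n)) {p q : Fin n} (hpq : p < q)
    (h : ∀ i ∈ descentSet w, (p : ℕ) < i → (q : ℕ) < i) : w p < w q := by
  obtain ⟨q, hq⟩ := q
  induction q with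
  | zero => exact absurd hpq (by simp [Fin.lt_def])
  | succ m ih =>
    have hstep : w ⟨m, by omega⟩ < w ⟨m + 1, hq⟩ := by
      refine lt_of_le_of_ne (not_lt.mp fun hlt => ?_) fun he => by simpa using w.injective he
      have := h (m + 1) (mem_descentSet.mpr ⟨⟨m, by omega⟩, ⟨m + 1, hq⟩, rfl, rfl, hlt⟩)
        (by simpa [Fin.lt_def] using hpq)
      simp at this
    rcases Nat.lt_or_ge (p : ℕ) m with hp | hp
    · refine (ih (by omega) (by simpa [Fin.lt_def] using hp) fun i hi hpi => ?_).trans hstep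
      have := h i hi hpi
      simp only at this ⊢
      omega
    · have : p = ⟨m, by omega⟩ := Fin.ext (by
        have := Fin.lt_def.mp hpq
        simp only at this ⊢
        omega)
      rwa [this]

theorem descentSet_eq_iff (w : Equiv.Perm (Fin n)) :
    descentSet w = Finset.Ioo 0 n ↔ w = Fin.revPerm := by
  constructor
  · intro h
    rcases n with _ | m
    · exact Subsingleton.elim _ _
    have hanti : StrictAnti w := Fin.strictAnti_iff_succ_lt.mpr fun i => by
      have hm : (i : ℕ) + 1 ∈ descentSet w := by
        rw [h, Finset.mem_Ioo]
        omega
      obtain ⟨p, q, h1, h2, h3⟩ := mem_descentSet.mp hm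
      have hq : i.succ = q := Fin.ext (by rw [Fin.val_succ, h2])
      have hp : i.castSucc = p := Fin.ext (by rw [Fin.val_castSucc]; omega)
      rwa [hq, hp]
    have hm : StrictMono (w ∘ Fin.rev) := hanti.comp Fin.rev_strictAnti
    have : w ∘ Fin.rev = id := by
      have e := Subsingleton.elim
        (hm.orderIsoOfSurjective _ (w.surjective.comp Fin.rev_surjective)) (OrderIso.refl _)
      funext x
      exact congrArg (fun f : Fin (m + 1) ≃o Fin (m + 1) => f x) e
    ext x
    have := congrFun this (Fin.rev x)
    simp only [Function.comp_apply, Fin.rev_rev, id] at this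
    rw [this, Fin.revPerm_apply]
  · rintro rfl
    refine (descentSet_subset _).antisymm fun j hj => ?_
    rw [Finset.mem_Ioo] at hj
    refine mem_descentSet.mpr ⟨⟨j - 1, by omega⟩, ⟨j, hj.2⟩, ?_, rfl, ?_⟩
    · simp only; omega
    · rw [Fin.revPerm_apply, Fin.revPerm_apply, Fin.rev_lt_rev, Fin.lt_def]
      simp only
      omega

end DescentAlgebra

/-! ### Face sums acting on chambers -/

namespace WeakOrder

open DescentAlgebra

variable {n : ℕ}

/-- All descents of `w` sit at cuts, so within each block the list `σ * w` already runs in the order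
of `σ`, which is how the product breaks ties. -/
theorem cutFace_mul_chamber (σ w : Equiv.Perm (Fin n)) {I : Finset ℕ} (h : descentSet w ⊆ I) :
    cutFace (σ * w) I * chamber σ = chamber (σ * w) := by
  ext a b
  obtain ⟨p, rfl⟩ := (σ * w).surjective a
  obtain ⟨q, rfl⟩ := (σ * w).surjective b
  have e : ∀ p, σ.symm ((σ * w) p) = w p := fun p => by simp
  simp only [mul_le, cutFace_le, chamber_le, Equiv.symm_apply_apply, e]
  constructor
  · rintro ⟨h₁, h₂⟩
    by_contra hlt
    rw [not_le] at hlt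
    have := h₂ fun i _ hi => lt_trans hlt hi
    exact absurd (lt_of_no_descent w hlt fun i hi => h₁ i (h hi)) (not_lt.mpr this)
  · intro hpq
    refine ⟨fun i _ hi => lt_of_le_of_lt hpq hi, fun h₂ => ?_⟩
    rcases hpq.eq_or_lt with rfl | hlt
    · exact le_rfl
    · exact (lt_of_no_descent w hlt fun i hi => h₂ i (h hi)).le

/-- A descent of `w` away from the cuts would leave two tied elements in the order opposite to that
of `σ`. -/
theorem eq_cutFace_of_mul_chamber {F : WeakOrder n} {σ w : Equiv.Perm (Fin n)}
    (h : F * chamber σ = chamber (σ * w)) :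
    F = cutFace (σ * w) F.sizes ∧ descentSet w ⊆ F.sizes := by
  have hF : F = cutFace (σ * w) F.sizes := eq_cutFace fun a b hab => by
    rw [← h] at hab
    exact hab.1
  refine ⟨hF, fun j hj => ?_⟩
  obtain ⟨p, q, hpq, rfl, hlt⟩ := mem_descentSet.mp hj
  by_contra hj
  have hle : (chamber (σ * w)).le ((σ * w) p) ((σ * w) q) := by
    simp only [chamber_le, Equiv.symm_apply_apply, Fin.le_def]
    omega
  rw [← h] at hle
  refine absurd (hle.2 ?_) ?_
  · rw [hF]
    intro i hi hip
    simp only [Equiv.symm_apply_apply] at hip ⊢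
    refine lt_of_le_of_ne (by omega) fun e => hj (by rwa [e])
  · simpa [chamber_le] using hlt

variable (k : Type*) [Field k]

open Classical in
/-- The sum of all weak orders whose proper nonempty lower sets have the given sizes. -/
noncomputable def faceSum (n : ℕ) (I : Finset ℕ) : MonoidAlgebra k (WeakOrder n) :=
  ∑ F ∈ Finset.univ.filter (fun F : WeakOrder n => F.sizes = I), MonoidAlgebra.of k _ F

/-- The signed sum of all weak orders. -/
noncomputable def signSum (n : ℕ) : MonoidAlgebra k (WeakOrder n) :=
  ∑ F : WeakOrder n, (-1 : k) ^ (n - F.length) • MonoidAlgebra.of k _ F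

theorem signSum_eq : signSum k n = ∑ I ∈ (Finset.Ioo 0 n).powerset,
    (-1 : k) ^ (n - 1 - I.card) • faceSum k n I := by
  classical
  rw [signSum, ← Finset.sum_fiberwise_of_maps_to (s := Finset.univ) (g := sizes)
    (t := (Finset.Ioo 0 n).powerset) fun F _ => Finset.mem_powerset.mpr F.sizes_subset]
  refine Finset.sum_congr rfl fun I _ => ?_
  rw [faceSum, Finset.smul_sum]
  refine Finset.sum_congr (by congr) fun F hF => ?_
  rw [sub_length_eq, (Finset.mem_filter.mp hF).2]

theorem faceSum_mul_chamber {I : Finset ℕ} (hI : I ⊆ Finset.Ioo 0 n) (σ : Equiv.Perm (Fin n)) :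
    faceSum k n I * MonoidAlgebra.of k _ (chamber σ) =
      ∑ w ∈ Finset.univ.filter (fun w : Equiv.Perm (Fin n) => descentSet w ⊆ I),
        MonoidAlgebra.of k _ (chamber (σ * w)) := by
  classical
  rw [faceSum, Finset.sum_mul]
  symm
  refine Finset.sum_bij (fun w _ => cutFace (σ * w) I) ?_ ?_ ?_ ?_
  · intro w _
    simp [sizes_cutFace _ hI]
  · intro w hw w' hw' h
    have e := cutFace_mul_chamber σ w (Finset.mem_filter.mp hw).2
    rw [h, cutFace_mul_chamber σ w' (Finset.mem_filter.mp hw').2] at e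
    exact mul_left_cancel (chamber_injective e.symm)
  · intro F hF
    obtain ⟨τ, hτ⟩ := exists_mul_chamber F σ
    rw [← mul_inv_cancel_left σ τ] at hτ
    obtain ⟨h₁, h₂⟩ := eq_cutFace_of_mul_chamber hτ
    rw [(Finset.mem_filter.mp hF).2] at h₁ h₂
    exact ⟨σ⁻¹ * τ, by simpa using h₂, h₁.symm⟩
  · intro w hw
    rw [← map_mul, cutFace_mul_chamber σ w (Finset.mem_filter.mp hw).2]

/-- Complementation turns this into the alternating sum over the subsets of `N \ D`. -/
theorem sum_powerset_superset_neg_one_pow (N D : Finset ℕ) (hD : D ⊆ N) :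
    ∑ I ∈ N.powerset.filter (fun I => D ⊆ I), (-1 : k) ^ (N.card - I.card) =
      if D = N then 1 else 0 := by
  have h := congrArg (Int.cast : ℤ → k) (Finset.sum_powerset_neg_one_pow_card (x := N \ D))
  have e : (N \ D = ∅) ↔ D = N := by
    rw [Finset.sdiff_eq_empty_iff_subset]
    exact ⟨fun h => hD.antisymm h, fun h => h.ge⟩
  simp only [e, Int.cast_sum, Int.cast_pow, Int.cast_neg, Int.cast_one, Int.cast_ite,
    Int.cast_zero] at h
  rw [← h]
  refine Finset.sum_bij' (fun I _ => N \ I) (fun J _ => N \ J) ?_ ?_ ?_ ?_ ?_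
  · intro I hI
    exact Finset.mem_powerset.mpr (Finset.sdiff_subset_sdiff le_rfl (Finset.mem_filter.mp hI).2)
  · intro J hJ
    rw [Finset.mem_powerset, Finset.subset_sdiff] at hJ
    refine Finset.mem_filter.mpr ⟨Finset.mem_powerset.mpr Finset.sdiff_subset, ?_⟩
    exact Finset.subset_sdiff.mpr ⟨hD, hJ.2.symm⟩
  · intro I hI
    exact Finset.sdiff_sdiff_eq_self (Finset.mem_powerset.mp (Finset.mem_filter.mp hI).1)
  · intro J hJ
    exact Finset.sdiff_sdiff_eq_self ((Finset.mem_powerset.mp hJ).trans Finset.sdiff_subset)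
  · intro I hI
    rw [Finset.card_sdiff_of_subset (Finset.mem_powerset.mp (Finset.mem_filter.mp hI).1)]

/-- The coefficient of `chamber (σ * w)` is an alternating sum over the sets containing the descents
of `w`; it vanishes unless every position is a descent. -/
theorem signSum_mul_chamber (σ : Equiv.Perm (Fin n)) :
    signSum k n * MonoidAlgebra.of k _ (chamber σ) =
      MonoidAlgebra.of k _ (chamber (σ * Fin.revPerm)) := by
  classical
  rw [signSum_eq, Finset.sum_mul]
  have h : ∀ I ∈ (Finset.Ioo 0 n).powerset,
      ((-1 : k) ^ (n - 1 - I.card) • faceSum k n I) * MonoidAlgebra.of k _ (chamber σ) =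
        ∑ w : Equiv.Perm (Fin n), (if descentSet w ⊆ I then (-1 : k) ^ (n - 1 - I.card) else 0) •
          MonoidAlgebra.of k _ (chamber (σ * w)) := by
    intro I hI
    rw [smul_mul_assoc, faceSum_mul_chamber k (Finset.mem_powerset.mp hI), Finset.sum_filter,
      Finset.smul_sum]
    refine Finset.sum_congr rfl fun w _ => ?_
    split_ifs <;> simp
  rw [Finset.sum_congr rfl h, Finset.sum_comm]
  have h' : ∀ w : Equiv.Perm (Fin n), ∑ I ∈ (Finset.Ioo 0 n).powerset,
      (if descentSet w ⊆ I then (-1 : k) ^ (n - 1 - I.card) else 0) •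
          MonoidAlgebra.of k _ (chamber (σ * w)) =
      if w = Fin.revPerm then MonoidAlgebra.of k _ (chamber (σ * w)) else 0 := by
    intro w
    rw [← Finset.sum_smul, ← Finset.sum_filter]
    have := sum_powerset_superset_neg_one_pow k (Finset.Ioo 0 n) (descentSet w)
      (descentSet_subset w)
    rw [Nat.card_Ioo, Nat.sub_zero] at this
    rw [this]
    simp only [descentSet_eq_iff]
    split_ifs <;> simp
  rw [Finset.sum_congr rfl fun w _ => h' w]
  simp

/-- The linear map sending a permutation to the corresponding chamber. -/
noncomputable def chamberMap :
    MonoidAlgebra k (Equiv.Perm (Fin n)) →ₗ[k] MonoidAlgebra k (WeakOrder n) :=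
  MonoidAlgebra.mapDomainLinearMap k k chamber

theorem chamberMap_of (σ : Equiv.Perm (Fin n)) :
    chamberMap k (MonoidAlgebra.of k _ σ) = MonoidAlgebra.of k _ (chamber σ) :=
  MonoidAlgebra.mapDomainLinearMap_single ..

theorem chamberMap_injective :
    Function.Injective (chamberMap k : MonoidAlgebra k (Equiv.Perm (Fin n)) →ₗ[k] _) :=
  MonoidAlgebra.mapDomain_injective chamber_injective

theorem faceSum_mul_chamberMap {I : Finset ℕ} (hI : I ⊆ Finset.Ioo 0 n)
    (x : MonoidAlgebra k (Equiv.Perm (Fin n))) :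
    faceSum k n I * chamberMap k x = chamberMap k (x * BSet k n I) := by
  induction x using MonoidAlgebra.induction_on with
  | of σ =>
    rw [chamberMap_of, faceSum_mul_chamber k hI, BSet, Finset.mul_sum, map_sum]
    exact Finset.sum_congr rfl fun w _ => by rw [← map_mul, chamberMap_of]
  | add x y hx hy => rw [map_add, mul_add, hx, hy, add_mul, map_add]
  | smul r x hx => rw [map_smul, mul_smul_comm, hx, smul_mul_assoc, map_smul]

theorem signSum_mul_chamberMap (x : MonoidAlgebra k (Equiv.Perm (Fin n))) :
    signSum k n * chamberMap k x = chamberMap k (x * w₀ k n) := by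
  induction x using MonoidAlgebra.induction_on with
  | of σ => rw [chamberMap_of, signSum_mul_chamber, w₀, ← map_mul, chamberMap_of]
  | add x y hx hy => rw [map_add, mul_add, hx, hy, add_mul, map_add]
  | smul r x hx => rw [map_smul, mul_smul_comm, hx, smul_mul_assoc, map_smul]

theorem w₀_mul_w₀ : w₀ k n * w₀ k n = 1 := by
  rw [w₀, ← map_mul]
  have : (Fin.revPerm * Fin.revPerm : Equiv.Perm (Fin n)) = 1 := by
    ext x
    simp
  rw [this, map_one]

theorem aeval_mul_chamberMap {I : Finset ℕ} (hI : I ⊆ Finset.Ioo 0 n) (q : k[X])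
    (x : MonoidAlgebra k (Equiv.Perm (Fin n))) :
    aeval (faceSum k n I * signSum k n) q * chamberMap k x =
      chamberMap k (x * aeval (w₀ k n * BSet k n I) q) := by
  induction q using Polynomial.induction_on generalizing x with
  | C a => simp [Algebra.algebraMap_eq_smul_one]
  | add p q hp hq => rw [map_add, add_mul, hp, hq, map_add, mul_add, map_add]
  | monomial m a h =>
    rw [pow_succ, ← mul_assoc, map_mul, aeval_X, mul_assoc, mul_assoc (faceSum k n I),
      signSum_mul_chamberMap, faceSum_mul_chamberMap k hI, h, mul_comm (C a * X ^ m) X,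
      map_mul (aeval _) X, aeval_X]
    simp only [mul_assoc]

/-! ### Faithfulness of the chamber representation -/

open Classical in
/-- The coefficient functional summing over the weak orders that satisfy a predicate. -/
noncomputable def coeffSum (P : WeakOrder n → Prop) : MonoidAlgebra k (WeakOrder n) →ₗ[k] k :=
  (MonoidAlgebra.basis (WeakOrder n) k).constr k fun F => if P F then 1 else 0

open Classical in
theorem coeffSum_of (P : WeakOrder n → Prop) (F : WeakOrder n) :
    coeffSum k P (MonoidAlgebra.of k _ F) = if P F then 1 else 0 := by
  have := (MonoidAlgebra.basis (WeakOrder n) k).constr_basis k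
    (fun F => if P F then (1 : k) else 0) F
  rwa [MonoidAlgebra.basis_apply] at this

theorem eq_zero_of_coeffSum_eq (y : MonoidAlgebra k (WeakOrder n))
    (h : ∀ G, coeffSum k (fun F => F = G) y = 0) : y = 0 := by
  classical
  ext G
  rw [MonoidAlgebra.coeff_zero, Finsupp.zero_apply, ← h G]
  clear h
  induction y using MonoidAlgebra.induction_on with
  | of F => rw [coeffSum_of, MonoidAlgebra.of_apply, MonoidAlgebra.coeff_single,
      Finsupp.single_apply]
  | add x y hx hy => rw [MonoidAlgebra.coeff_add, Finsupp.add_apply, hx, hy, map_add]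
  | smul r x hx => rw [MonoidAlgebra.coeff_smul, Finsupp.smul_apply, hx, map_smul]

theorem exists_representatives (G : WeakOrder n) : ∃ rep : Fin n → Fin n,
    (∀ x, G.le x (rep x) ∧ G.le (rep x) x) ∧ (∀ x y, G.le x y → G.le y x → rep x = rep y) := by
  have hr : ∀ x y, G.rank x = G.rank y ↔ G.le x y ∧ G.le y x := fun x y => by
    rw [le_iff_rank_le, le_iff_rank_le, le_antisymm_iff]
  refine ⟨fun x => (Quotient.mk (Setoid.ker G.rank) x).out, fun x => ?_, fun x y h₁ h₂ => ?_⟩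
  · exact (hr _ _).mp (Quotient.exact (Quotient.out_eq (Quotient.mk (Setoid.ker G.rank) x))).symm
  · exact congrArg Quotient.out (Quotient.sound (s := Setoid.ker G.rank) ((hr x y).mpr ⟨h₁, h₂⟩))

/-- An element of the face algebra is determined by its action on chambers. -/
theorem eq_zero_of_mul_chamber (y : MonoidAlgebra k (WeakOrder n))
    (h : ∀ σ, y * MonoidAlgebra.of k _ (chamber σ) = 0) : y = 0 := by
  classical
  refine eq_zero_of_coeffSum_eq k y fun G => ?_
  obtain ⟨rep, hrep, hrep'⟩ := exists_representatives G
  have hidem : ∀ x, rep (rep x) = rep x := fun x => hrep' _ _ (hrep x).2 (hrep x).1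
  -- The coefficient of `G` is recovered from the products with the chambers `E T`, for sets `T` of
  -- non-representatives. `E T` puts the elements of `J \ T` before all representatives and those of
  -- `T` after them; `G.opposite` reverses the representatives, so a tie between classes in `F` can
  -- never be broken in favour of `G`.
  let J : Finset (Fin n) := Finset.univ.filter fun x => rep x ≠ x
  let Q : WeakOrder n → Prop := fun F => ∀ x y, ¬ G.le y x → ¬ F.le (rep y) (rep x)
  let H : Finset (Fin n) → WeakOrder n := fun T =>
    ofFun (fun x => if rep x = x then (0 : ℤ) else if x ∈ T then 1 else -1)
  let E : Finset (Fin n) → WeakOrder n := fun T => H T * G.opposite * chamber 1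
  let P : WeakOrder n → Prop := fun D => (∀ x ∈ J, ¬ D.le (rep x) x) ∧ Q D
  have hE : ∀ T, ∃ τ, E T = chamber τ := fun T => exists_mul_chamber _ _
  have hQ : ∀ F T, Q (F * E T) ↔ Q F := by
    intro F T
    refine forall₃_congr fun x y hxy => not_congr ⟨fun h => h.1, fun h => ⟨h, fun _ => ?_⟩⟩
    have h1 : G.le (rep x) (rep y) :=
      G.trans (hrep x).2 (G.trans (G.le_of_not_le hxy) (hrep y).1)
    have h2 : ¬ G.le (rep y) (rep x) := fun h =>
      hxy (G.trans (hrep y).1 (G.trans h (hrep x).2))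
    refine ⟨⟨?_, fun _ => h1⟩, fun h => absurd (h.2 ?_) h2⟩
    all_goals simp [H, ofFun, hidem]
  have hmem : ∀ F T, ∀ x ∈ J, x ∉ T → (¬ (F * E T).le (rep x) x ↔ F.le x (rep x)) := by
    intro F T x hx hT
    have hx' : rep x ≠ x := (Finset.mem_filter.mp hx).2
    have hn : ¬ (E T).le (rep x) x := fun h => by
      have := h.1.1
      simp [H, ofFun, hidem, hx', hT] at this
    rw [mul_le]
    have := F.total x (rep x)
    tauto
  have hnmem : ∀ F T, ∀ x ∈ J, x ∈ T → (¬ (F * E T).le (rep x) x ↔ ¬ F.le (rep x) x) := by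
    intro F T x hx hT
    have hx' : rep x ≠ x := (Finset.mem_filter.mp hx).2
    have hn : (E T).le (rep x) x := by
      refine ⟨⟨?_, fun h => ?_⟩, fun h => ?_⟩
      · simp [H, ofFun, hidem, hx', hT]
      · simp [H, ofFun, hidem, hx', hT] at h
      · have := h.1
        simp [H, ofFun, hidem, hx', hT] at this
    rw [mul_le]
    tauto
  have hG : ∀ F, F = G ↔ (∀ x ∈ J, F.le x (rep x) ∧ F.le (rep x) x) ∧ Q F := by
    intro F
    constructor
    · rintro rfl
      exact ⟨fun x _ => hrep x, fun x y hxy h =>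
        hxy (F.trans (hrep y).1 (F.trans h (hrep x).2))⟩
    · rintro ⟨h₁, h₂⟩
      have h₁' : ∀ x, F.le x (rep x) ∧ F.le (rep x) x := fun x => by
        by_cases hx : rep x = x
        · rw [hx]; exact ⟨F.refl x, F.refl x⟩
        · exact h₁ x (by simpa [J] using hx)
      ext a b
      constructor
      · intro hab
        by_contra hn
        exact h₂ b a hn (F.trans (h₁' a).2 (F.trans hab (h₁' b).1))
      · intro hab
        by_cases hba : G.le b a
        · have := hrep' a b hab hba
          exact F.trans (h₁' a).1 (this ▸ (h₁' b).2)
        · exact F.trans (h₁' a).1 (F.trans (F.le_of_not_le (h₂ a b hba)) (h₁' b).2)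
  have hand : ∀ (p q : Prop) [Decidable p] [Decidable q] [Decidable (p ∧ q)],
      (if p then (1 : k) else 0) * (if q then 1 else 0) = if p ∧ q then 1 else 0 := by
    intro p q _ _ _
    by_cases hp : p <;> by_cases hq : q <;> simp [hp, hq]
  have key : ∀ y, coeffSum k (fun F => F = G) y =
      ∑ T ∈ J.powerset, (-1 : k) ^ T.card * coeffSum k P (y * MonoidAlgebra.of k _ (E T)) := by
    intro y
    induction y using MonoidAlgebra.induction_on with
    | of F =>
      -- By totality, a tie indicator is a weak inequality minus a strict one. Expanding the product
      -- over `J` gives the signed sum over `T`, and each term is read off from `F * E T`.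
      have e : ∀ x ∈ J, (if F.le x (rep x) ∧ F.le (rep x) x then (1 : k) else 0) =
          (if F.le x (rep x) then (1 : k) else 0) - if ¬ F.le (rep x) x then 1 else 0 := by
        intro x _
        have := F.total x (rep x)
        by_cases h1 : F.le x (rep x) <;> by_cases h2 : F.le (rep x) x <;> simp_all
      have e' : (if F = G then (1 : k) else 0) = (∏ x ∈ J,
          ((if F.le x (rep x) then (1 : k) else 0) - if ¬ F.le (rep x) x then 1 else 0)) *
          if Q F then 1 else 0 := by
        rw [← Finset.prod_congr rfl e, Finset.prod_boole, hand]
        exact if_congr (hG F) rfl rfl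
      rw [coeffSum_of, e', Finset.prod_sub, Finset.sum_mul]
      refine Finset.sum_congr rfl fun T hT => ?_
      rw [Finset.mem_powerset] at hT
      rw [← map_mul, coeffSum_of, Finset.prod_boole, Finset.prod_boole, mul_assoc, mul_assoc,
        hand, hand]
      congr 1
      have hiff : ((∀ x ∈ J \ T, F.le x (rep x)) ∧ (∀ x ∈ T, ¬ F.le (rep x) x) ∧ Q F) ↔
          P (F * E T) := ?_
      · by_cases hP : P (F * E T)
        · rw [if_pos hP, if_pos (hiff.mpr hP)]
        · rw [if_neg hP, if_neg (mt hiff.mp hP)]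
      constructor
      · rintro ⟨h1, h2, h3⟩
        refine ⟨fun x hx => ?_, (hQ F T).mpr h3⟩
        by_cases hxT : x ∈ T
        · exact (hnmem F T x hx hxT).mpr (h2 x hxT)
        · exact (hmem F T x hx hxT).mpr (h1 x (Finset.mem_sdiff.mpr ⟨hx, hxT⟩))
      · rintro ⟨h1, h2⟩
        refine ⟨fun x hx => ?_, fun x hx => ?_, (hQ F T).mp h2⟩
        · rw [Finset.mem_sdiff] at hx
          exact (hmem F T x hx.1 hx.2).mp (h1 x hx.1)
        · exact (hnmem F T x (hT hx) hx).mp (h1 x (hT hx))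
    | add x y hx hy =>
      rw [map_add, hx, hy, ← Finset.sum_add_distrib]
      exact Finset.sum_congr rfl fun T _ => by rw [add_mul, map_add, mul_add]
    | smul r x hx =>
      rw [map_smul, hx, smul_eq_mul, Finset.mul_sum]
      exact Finset.sum_congr rfl fun T _ => by rw [smul_mul_assoc, map_smul, smul_eq_mul]; ring
  rw [key]
  refine Finset.sum_eq_zero fun T _ => ?_
  obtain ⟨τ, hτ⟩ := hE T
  rw [hτ, h, map_zero, mul_zero]

theorem signSum_mul_signSum : signSum k n * signSum k n = 1 := by
  rw [← sub_eq_zero]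
  refine eq_zero_of_mul_chamber k _ fun σ => ?_
  rw [sub_mul, one_mul, ← chamberMap_of, mul_assoc, signSum_mul_chamberMap, signSum_mul_chamberMap,
    mul_assoc, w₀_mul_w₀, mul_one, sub_self]

/-- One direction is faithfulness on chambers, the other the injectivity of `chamberMap` evaluated
at 1. -/
theorem aeval_eq_zero_iff {I : Finset ℕ} (hI : I ⊆ Finset.Ioo 0 n) (q : k[X]) :
    aeval (w₀ k n * BSet k n I) q = 0 ↔ aeval (faceSum k n I * signSum k n) q = 0 := by
  constructor
  · intro h
    refine eq_zero_of_mul_chamber k _ fun σ => ?_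
    rw [← chamberMap_of, aeval_mul_chamberMap k hI, h, mul_zero, map_zero]
  · intro h
    have := aeval_mul_chamberMap k hI q 1
    rw [h, zero_mul, one_mul] at this
    exact chamberMap_injective k (by rw [← this, map_zero])

end WeakOrder

/-! ### Characters, nilpotency and the knapsack filtration -/

namespace WeakOrder

open DescentAlgebra

variable {n : ℕ}

/-- Elements tied in `G` are tied in `F`. -/
def TiesLE (G F : WeakOrder n) : Prop := ∀ a b, G.le a b → G.le b a → F.le a b

theorem tiesLE_iff_mul_eq {G F : WeakOrder n} : TiesLE G F ↔ G * F = G := by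
  constructor
  · intro h
    ext a b
    exact ⟨fun hab => hab.1, fun hab => ⟨hab, fun hba => h a b hab hba⟩⟩
  · intro h a b hab hba
    rw [← h] at hab
    exact hab.2 hba

theorem tiesLE_mul {G F F' : WeakOrder n} : TiesLE G (F * F') ↔ TiesLE G F ∧ TiesLE G F' := by
  constructor
  · exact fun h => ⟨fun a b hab hba => (h a b hab hba).1,
      fun a b hab hba => (h a b hab hba).2 (h b a hba hab).1⟩
  · exact fun h a b hab hba => ⟨h.1 a b hab hba, fun _ => h.2 a b hab hba⟩

theorem TiesLE.mul_left {G F' : WeakOrder n} (h : TiesLE G F') (F : WeakOrder n) :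
    TiesLE (G * F) F' := fun a b hab hba => h a b hab.1 hba.1

theorem tiesLE_mul_self (G F : WeakOrder n) : TiesLE (G * F) F := fun _ _ hab hba => hab.2 hba.1

open Classical in
/-- The number of weak orders with lower sets of the given sizes that have all ties of `G`. -/
noncomputable def numFaces (I : Finset ℕ) (G : WeakOrder n) : ℕ :=
  (Finset.univ.filter fun F : WeakOrder n => F.sizes = I ∧ TiesLE G F).card

theorem numFaces_le_mul (I : Finset ℕ) (G F : WeakOrder n) : numFaces I G ≤ numFaces I (G * F) := by
  refine Finset.card_le_card fun F' h => ?_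
  simp only [Finset.mem_filter, Finset.mem_univ, true_and] at h ⊢
  exact ⟨h.1, h.2.mul_left F⟩

/-- Multiplying by `F` only removes ties, and `F` itself is newly counted. -/
theorem numFaces_lt_mul {I : Finset ℕ} {G F : WeakOrder n} (hF : F.sizes = I) (h : ¬ TiesLE G F) :
    numFaces I G < numFaces I (G * F) := by
  refine Finset.card_lt_card ?_
  rw [Finset.ssubset_iff_of_subset]
  · exact ⟨F, by simpa using ⟨hF, tiesLE_mul_self G F⟩, by simp [h]⟩
  · intro F' h
    simp only [Finset.mem_filter, Finset.mem_univ, true_and] at h ⊢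
    exact ⟨h.1, h.2.mul_left F⟩

theorem numFaces_le_card (I : Finset ℕ) (G : WeakOrder n) :
    numFaces I G ≤ Fintype.card (WeakOrder n) := Finset.card_le_univ _

variable (k : Type*) [Field k]

open Classical in
/-- The character of the face algebra attached to the set partition underlying `G`. -/
noncomputable def supportChar (G : WeakOrder n) : MonoidAlgebra k (WeakOrder n) →ₐ[k] k :=
  MonoidAlgebra.lift k k (WeakOrder n)
    { toFun := fun F => if TiesLE G F then 1 else 0
      map_one' := if_pos fun _ _ _ _ => trivial
      map_mul' := fun F F' => by
        by_cases h : TiesLE G F <;> by_cases h' : TiesLE G F' <;> simp [tiesLE_mul, h, h'] }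

open Classical in
theorem supportChar_of (G F : WeakOrder n) :
    supportChar k G (MonoidAlgebra.of k _ F) = if TiesLE G F then 1 else 0 :=
  MonoidAlgebra.lift_of _ _

theorem supportChar_faceSum (I : Finset ℕ) (G : WeakOrder n) :
    supportChar k G (faceSum k n I) = numFaces I G := by
  classical
  rw [faceSum, map_sum, Finset.sum_congr rfl fun F _ => supportChar_of k G F, Finset.sum_boole,
    Finset.filter_filter, numFaces]

/-- This is the augmentation applied to the identity sending one chamber to another. -/
theorem sum_neg_one_pow (r : ℕ) : ∑ F : WeakOrder r, (-1 : k) ^ (r - F.length) = 1 := by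
  have h := congrArg (MonoidAlgebra.lift k k (WeakOrder r) 1) (signSum_mul_chamber k (n := r) 1)
  rw [map_mul, MonoidAlgebra.lift_of, MonoidAlgebra.lift_of, MonoidHom.one_apply,
    MonoidHom.one_apply, mul_one, signSum, map_sum] at h
  refine Eq.trans (Finset.sum_congr rfl fun F _ => ?_) h
  rw [map_smul, MonoidAlgebra.lift_of, MonoidHom.one_apply, smul_eq_mul, mul_one]

theorem exists_surjective (G : WeakOrder n) : ∃ g : Fin n → Fin G.length,
    Function.Surjective g ∧ ∀ a b, G.le a b ↔ g a ≤ g b := by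
  let e : Fin G.length ≃o _ := (Finset.univ.image G.rank).orderIsoOfFin rfl
  have hm : ∀ a, G.rank a ∈ Finset.univ.image G.rank := fun a =>
    Finset.mem_image_of_mem _ (Finset.mem_univ a)
  refine ⟨fun a => e.symm ⟨G.rank a, hm a⟩, fun j => ?_, fun a b => ?_⟩
  · obtain ⟨a, -, ha⟩ := Finset.mem_image.mp (e j).2
    exact ⟨a, e.symm_apply_eq.mpr (Subtype.ext ha)⟩
  · exact (G.le_iff_rank_le a b).trans (e.symm.le_iff_le (x := ⟨_, hm a⟩) (y := ⟨_, hm b⟩)).symm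

/-- The faces having all ties of `G` are the weak orders on its classes, whose signed sum is 1; the
change of ground set from n to ℓ(G) elements accounts for the sign. -/
theorem supportChar_signSum (G : WeakOrder n) :
    supportChar k G (signSum k n) = (-1) ^ (n - G.length) := by
  classical
  obtain ⟨g, hg, hle⟩ := exists_surjective G
  have h₁ : supportChar k G (signSum k n) =
      ∑ F ∈ Finset.univ.filter (fun F => TiesLE G F), (-1 : k) ^ (n - F.length) := by
    rw [signSum, map_sum, Finset.sum_filter]
    refine Finset.sum_congr rfl fun F _ => ?_
    rw [map_smul, supportChar_of, smul_eq_mul, mul_ite, mul_one, mul_zero]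
  have h₂ : ∑ F' : WeakOrder G.length, (-1 : k) ^ (n - F'.length) =
      ∑ F ∈ Finset.univ.filter (fun F => TiesLE G F), (-1 : k) ^ (n - F.length) := by
    refine Finset.sum_bij (fun F' _ => F'.comap g) ?_ ?_ ?_ ?_
    · intro F' _
      refine Finset.mem_filter.mpr ⟨Finset.mem_univ _, fun a b hab hba => ?_⟩
      have : g a = g b := le_antisymm ((hle _ _).mp hab) ((hle _ _).mp hba)
      change F'.le (g a) (g b)
      rw [this]
      exact F'.refl _
    · intro F₁ _ F₂ _ h
      ext i j
      obtain ⟨a, rfl⟩ := hg i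
      obtain ⟨b, rfl⟩ := hg j
      change (F₁.comap g).le a b ↔ (F₂.comap g).le a b
      rw [h]
    · intro F hF
      have hF := (Finset.mem_filter.mp hF).2
      refine ⟨F.comap (Function.surjInv hg), Finset.mem_univ _, ?_⟩
      have hs : ∀ a, F.le (Function.surjInv hg (g a)) a ∧ F.le a (Function.surjInv hg (g a)) := by
        intro a
        have h : g (Function.surjInv hg (g a)) = g a := Function.surjInv_eq hg _
        exact ⟨hF _ _ ((hle _ _).mpr h.le) ((hle _ _).mpr h.ge),
          hF _ _ ((hle _ _).mpr h.ge) ((hle _ _).mpr h.le)⟩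
      ext a b
      change F.le _ _ ↔ F.le a b
      exact ⟨fun h => F.trans (hs a).2 (F.trans h (hs b).1),
        fun h => F.trans (hs a).1 (F.trans h (hs b).2)⟩
    · intro F' _
      rw [length_comap g hg]
  have h₃ := congrArg ((-1 : k) ^ (n - G.length) * ·) (sum_neg_one_pow k G.length)
  simp only [mul_one, Finset.mul_sum] at h₃
  rw [h₁, ← h₂, ← h₃]
  refine Finset.sum_congr rfl fun F' _ => ?_
  rw [← pow_add]
  congr 1
  have := F'.length_le
  have := G.length_le
  omega

/-- The number of comparable ordered pairs. -/
noncomputable def numLE (G : WeakOrder n) : ℕ := {p : Fin n × Fin n | G.le p.1 p.2}.ncard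

theorem numLE_mul_lt {G F : WeakOrder n} (h : ¬ TiesLE G F) : (G * F).numLE < G.numLE := by
  refine Set.ncard_lt_ncard ⟨fun p hp => hp.1, fun hsub => h ?_⟩ (Set.toFinite _)
  exact fun a b hab hba => (hsub (a := (a, b)) hab).2 hba

/-- Triangularity: each `G * F` either equals `G`, precisely when the character is 1 on `F`, or lies
in `W`. -/
theorem of_mul_sub_mem (W : Submodule k (MonoidAlgebra k (WeakOrder n))) (G : WeakOrder n)
    (hW : ∀ F, ¬ TiesLE G F → MonoidAlgebra.of k _ (G * F) ∈ W)
    (y : MonoidAlgebra k (WeakOrder n)) :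
    MonoidAlgebra.of k _ G * y - supportChar k G y • MonoidAlgebra.of k _ G ∈ W := by
  induction y using MonoidAlgebra.induction_on with
  | of F =>
    rw [supportChar_of, ← map_mul]
    by_cases h : TiesLE G F
    · rw [if_pos h, tiesLE_iff_mul_eq.mp h, one_smul, sub_self]
      exact W.zero_mem
    · rw [if_neg h, zero_smul, sub_zero]
      exact hW F h
  | add x y hx hy =>
    rw [mul_add, map_add, add_smul, add_sub_add_comm]
    exact W.add_mem hx hy
  | smul r x hx =>
    rw [mul_smul_comm, map_smul, smul_assoc, ← smul_sub]
    exact W.smul_mem r hx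

theorem span_mul_mem {S : Set (WeakOrder n)} {W : Submodule k (MonoidAlgebra k (WeakOrder n))}
    (f : MonoidAlgebra k (WeakOrder n) →ₗ[k] MonoidAlgebra k (WeakOrder n))
    (h : ∀ G ∈ S, f (MonoidAlgebra.of k _ G) ∈ W) {v : MonoidAlgebra k (WeakOrder n)}
    (hv : v ∈ Submodule.span k (MonoidAlgebra.of k _ '' S)) : f v ∈ W := by
  have : Submodule.span k (MonoidAlgebra.of k _ '' S) ≤ W.comap f := by
    rw [Submodule.span_le]
    rintro _ ⟨G, hG, rfl⟩
    exact h G hG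
  exact this hv

theorem isNilpotent_of_supportChar (y : MonoidAlgebra k (WeakOrder n))
    (hy : ∀ G, supportChar k G y = 0) : IsNilpotent y := by
  let W : ℕ → Submodule k (MonoidAlgebra k (WeakOrder n)) := fun m =>
    Submodule.span k (MonoidAlgebra.of k _ '' {G | G.numLE < m})
  -- The diagonal entries are the character values, all zero, so `y` strictly lowers the filtration
  -- by comparable pairs.
  have hstep : ∀ m, ∀ v ∈ W (m + 1), v * y ∈ W m := by
    intro m v hv
    refine span_mul_mem k (LinearMap.mulRight k y) (fun G hG => ?_) hv
    have := of_mul_sub_mem k (W m) G (fun F hF => Submodule.subset_span ⟨_, ?_, rfl⟩) y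
    · rwa [hy, zero_smul, sub_zero] at this
    · exact lt_of_lt_of_le (numLE_mul_lt hF) (Nat.lt_succ_iff.mp hG)
  have hpow : ∀ m, ∀ v ∈ W m, v * y ^ m = 0 := by
    intro m
    induction m with
    | zero =>
      intro v hv
      have : W 0 = ⊥ := by simp [W]
      rw [this, Submodule.mem_bot] at hv
      rw [hv, zero_mul]
    | succ m ih =>
      intro v hv
      rw [pow_succ', ← mul_assoc]
      exact ih _ (hstep m v hv)
  refine ⟨(1 : WeakOrder n).numLE + 1, ?_⟩
  have := hpow _ (MonoidAlgebra.of k _ 1) (Submodule.subset_span ⟨1, Nat.lt_succ_self _, rfl⟩)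
  rwa [map_one, one_mul] at this

/-- The span of the weak orders with at least `t` faces of type `I`. -/
noncomputable def faceFiltration (I : Finset ℕ) (t : ℕ) :
    Submodule k (MonoidAlgebra k (WeakOrder n)) :=
  Submodule.span k (MonoidAlgebra.of k _ '' {G | t ≤ numFaces I G})

theorem mul_mem_faceFiltration {I : Finset ℕ} {t : ℕ} {v : MonoidAlgebra k (WeakOrder n)}
    (hv : v ∈ faceFiltration k I t) (y : MonoidAlgebra k (WeakOrder n)) :
    v * y ∈ faceFiltration k I t := by
  refine span_mul_mem k (LinearMap.mulRight k y) (fun G hG => ?_) hv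
  rw [LinearMap.mulRight_apply]
  induction y using MonoidAlgebra.induction_on with
  | of F =>
    rw [← map_mul]
    exact Submodule.subset_span ⟨_, le_trans hG (numFaces_le_mul I G F), rfl⟩
  | add x y hx hy => rw [mul_add]; exact Submodule.add_mem _ hx hy
  | smul r x hx => rw [mul_smul_comm]; exact Submodule.smul_mem _ r hx

theorem mul_faceSum_sub_mem {I : Finset ℕ} {t : ℕ} {v : MonoidAlgebra k (WeakOrder n)}
    (hv : v ∈ faceFiltration k I t) :
    v * faceSum k n I - (t : k) • v ∈ faceFiltration k I (t + 1) := by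
  classical
  refine span_mul_mem k (LinearMap.mulRight k (faceSum k n I) - (t : k) • LinearMap.id)
    (fun G hG => ?_) hv
  rw [LinearMap.sub_apply, LinearMap.mulRight_apply, LinearMap.smul_apply, LinearMap.id_apply]
  rcases (show t ≤ numFaces I G from hG).eq_or_lt with h | h
  · rw [h, ← supportChar_faceSum, faceSum, map_sum, Finset.mul_sum, Finset.sum_smul,
      ← Finset.sum_sub_distrib]
    refine Submodule.sum_mem _ fun F hF => ?_
    rw [supportChar_of, ← map_mul]
    by_cases hGF : TiesLE G F
    · rw [if_pos hGF, tiesLE_iff_mul_eq.mp hGF, one_smul, sub_self]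
      exact Submodule.zero_mem _
    · rw [if_neg hGF, zero_smul, sub_zero]
      exact Submodule.subset_span ⟨_, numFaces_lt_mul (Finset.mem_filter.mp hF).2 hGF, rfl⟩
  · have hG' : MonoidAlgebra.of k _ G ∈ faceFiltration k I (t + 1) :=
      Submodule.subset_span ⟨G, h, rfl⟩
    exact Submodule.sub_mem _ (mul_mem_faceFiltration k hG' _) (Submodule.smul_mem _ _ hG')

theorem mul_sq_sub_mem {I : Finset ℕ} {t : ℕ} {v : MonoidAlgebra k (WeakOrder n)}
    (hv : v ∈ faceFiltration k I t) :
    v * (faceSum k n I * signSum k n) * (faceSum k n I * signSum k n) - ((t : k) * t) • v ∈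
      faceFiltration k I (t + 1) := by
  have h : ∀ u ∈ faceFiltration k I t, u * (faceSum k n I * signSum k n) -
      (t : k) • (u * signSum k n) ∈ faceFiltration k I (t + 1) := by
    intro u hu
    have := mul_mem_faceFiltration k (mul_faceSum_sub_mem k hu) (signSum k n)
    rwa [sub_mul, smul_mul_assoc, mul_assoc] at this
  -- With x = bs, add (vx - t·vs)x and t((vs)x - t·vss); the middle terms cancel and s² = 1.
  have h₁ := mul_mem_faceFiltration k (h v hv) (faceSum k n I * signSum k n)
  have h₂ := Submodule.smul_mem _ (t : k) (h _ (mul_mem_faceFiltration k hv (signSum k n)))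
  have := Submodule.add_mem _ h₁ h₂
  rwa [sub_mul, smul_mul_assoc, smul_sub, sub_add_sub_cancel, mul_assoc v (signSum k n),
    signSum_mul_signSum, mul_one, smul_smul] at this

theorem Icc_neg_succ (m : ℕ) : Finset.Icc (-((m + 1 : ℕ) : ℤ)) ((m + 1 : ℕ) : ℤ) =
    insert ((m + 1 : ℕ) : ℤ) (insert (-((m + 1 : ℕ) : ℤ)) (Finset.Icc (-(m : ℤ)) m)) := by
  ext z
  simp only [Finset.mem_Icc, Finset.mem_insert]
  omega

theorem aeval_prod_mem (I : Finset ℕ) (m : ℕ) :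
    aeval (faceSum k n I * signSum k n) (∏ z ∈ Finset.Icc (-(m : ℤ)) m, (X - C (z : k))) ∈
      faceFiltration k I (m + 1) := by
  induction m with
  | zero =>
    -- On layer 0 already b acts as 0, so a single factor X suffices and 0 is not a repeated root.
    have h1 : (1 : MonoidAlgebra k (WeakOrder n)) ∈ faceFiltration k I 0 :=
      Submodule.subset_span ⟨1, Nat.zero_le _, map_one _⟩
    have := mul_mem_faceFiltration k (mul_faceSum_sub_mem k h1) (signSum k n)
    simpa using this
  | succ m ih =>
    rw [Icc_neg_succ, Finset.prod_insert, Finset.prod_insert]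
    rotate_left
    · simp
    · simp only [Finset.mem_insert, Finset.mem_Icc]; omega
    have := mul_sq_sub_mem k ih
    rw [← mul_assoc, mul_comm, map_mul]
    convert this using 1
    push_cast
    simp only [map_mul, map_sub, aeval_X, aeval_C, map_neg, Algebra.algebraMap_eq_smul_one]
    simp only [mul_sub, sub_mul, mul_smul_comm, smul_mul_assoc, mul_one, one_mul, smul_smul,
      sub_neg_eq_add, mul_add, mul_assoc, add_mul, smul_sub]
    module

theorem exists_aeval_prod_eq_zero (I : Finset ℕ) :
    ∃ m : ℕ, aeval (faceSum k n I * signSum k n)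
      (∏ z ∈ Finset.Icc (-(m : ℤ)) m, (X - C (z : k))) = 0 := by
  refine ⟨Fintype.card (WeakOrder n), ?_⟩
  have h := aeval_prod_mem k I (n := n) (Fintype.card (WeakOrder n))
  have : {G : WeakOrder n | Fintype.card (WeakOrder n) + 1 ≤ numFaces I G} = ∅ := by
    ext G
    have := numFaces_le_card I G
    simp only [Set.mem_ofPred_eq, Set.mem_empty_iff_false, iff_false]
    omega
  rwa [faceFiltration, this, Set.image_empty, Submodule.span_empty, Submodule.mem_bot] at h

theorem minpoly_w₀_mul_BSet [CharZero k] {I : Finset ℕ} (hI : I ⊆ Finset.Ioo 0 n) :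
    minpoly k (w₀ k n * BSet k n I) =
      ∏ z ∈ Finset.univ.image fun G : WeakOrder n =>
        (-1 : ℤ) ^ (n - G.length) * (numFaces I G : ℤ), (X - C (z : k)) := by
  set K := Finset.univ.image fun G : WeakOrder n =>
        (-1 : ℤ) ^ (n - G.length) * (numFaces I G : ℤ) with hK
  set p : k[X] := ∏ z ∈ K, (X - C (z : k)) with hp
  set x := faceSum k n I * signSum k n with hx
  have hχ : ∀ G : WeakOrder n, supportChar k G x =
      (((-1 : ℤ) ^ (n - G.length) * (numFaces I G : ℤ) : ℤ) : k) := by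
    intro G
    rw [hx, map_mul, supportChar_faceSum, supportChar_signSum]
    push_cast
    ring
  have hz := aeval_eq_zero_iff k hI
  have hpmonic : p.Monic := monic_prod_of_monic _ _ fun z _ => monic_X_sub_C _
  obtain ⟨m, hs⟩ := exists_aeval_prod_eq_zero k (n := n) I
  have hsq : Squarefree (∏ z ∈ Finset.Icc (-(m : ℤ)) m, (X - C (z : k))) := by
    refine Separable.squarefree ?_
    exact separable_prod_X_sub_C_iff'.mpr fun a _ b _ h => Int.cast_injective h
  have hms : minpoly k (w₀ k n * BSet k n I) ∣ _ := minpoly.dvd k _ ((hz _).mpr hs)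
  have hint : IsIntegral k (w₀ k n * BSet k n I) :=
    ⟨_, monic_prod_of_monic _ _ fun z _ => monic_X_sub_C _, (hz _).mpr hs⟩
  obtain ⟨N, hN⟩ := isNilpotent_of_supportChar k (aeval x p) fun G => by
    rw [← aeval_algHom_apply, hχ, coe_aeval_eq_eval, hp, eval_prod]
    refine Finset.prod_eq_zero (Finset.mem_image_of_mem _ (Finset.mem_univ G)) ?_
    simp
  have hmp : minpoly k (w₀ k n * BSet k n I) ∣ p := by
    -- A squarefree divisor of a power of `p` divides `p`.
    have h1 : minpoly k (w₀ k n * BSet k n I) ∣ p ^ (N + 1) :=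
      minpoly.dvd k _ ((hz _).mpr (by rw [map_pow, pow_succ, hN, zero_mul]))
    exact ((hsq.squarefree_of_dvd hms).dvd_pow_iff_dvd N.succ_ne_zero).mp h1
  have hpm : p ∣ minpoly k (w₀ k n * BSet k n I) := by
    refine Finset.prod_dvd_of_coprime (fun a _ b _ hab => ?_) fun z hz' => ?_
    · exact isCoprime_X_sub_C_of_isUnit_sub
        (sub_ne_zero.mpr fun h => hab (Int.cast_injective h)).isUnit
    · obtain ⟨G, -, rfl⟩ := Finset.mem_image.mp hz'
      have h := congrArg (supportChar k G) ((hz _).mp (minpoly.aeval k (w₀ k n * BSet k n I)))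
      rw [← aeval_algHom_apply, hχ, coe_aeval_eq_eval, map_zero] at h
      exact dvd_iff_isRoot.mpr h
  exact eq_of_monic_of_associated (minpoly.monic hint) hpmonic (associated_of_dvd_dvd hmp hpm)

end WeakOrder

/-! ### Diagonalizability from distinct linear factors -/

theorem isDiagonalizable_of_aeval_prod_eq_zero {k V : Type*} [Field k] [AddCommGroup V] [Module k V]
    (f : V →ₗ[k] V) (K : Finset k) (h : aeval f (∏ z ∈ K, (X - C z)) = 0) :
    IsDiagonalizable f := by
  classical
  let S : Set V := {v | ∃ c : k, f v = c • v}
  have hK : ∀ K : Finset k,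
      LinearMap.ker (aeval f (∏ z ∈ K, (X - C z))) ≤ Submodule.span k S := by
    intro K
    induction K using Finset.induction_on with
    | empty =>
      intro v hv
      simp only [Finset.prod_empty, map_one, LinearMap.mem_ker, Module.End.one_apply] at hv
      rw [hv]
      exact Submodule.zero_mem _
    | insert a K ha ih =>
      -- Coprime factors split the kernel of the product into a sum of kernels, so the eigenvectors
      -- span and a basis can be chosen among them.
      have hcop : IsCoprime (X - C a) (∏ z ∈ K, (X - C z)) := IsCoprime.prod_right fun z hz =>
        isCoprime_X_sub_C_of_isUnit_sub (sub_ne_zero.mpr fun e : a = z => ha (by rwa [e])).isUnit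
      rw [Finset.prod_insert ha, ← sup_ker_aeval_eq_ker_aeval_mul_of_coprime f hcop]
      refine sup_le (fun v hv => Submodule.subset_span ⟨a, ?_⟩) ih
      rw [LinearMap.mem_ker, map_sub, aeval_X, aeval_C, LinearMap.sub_apply,
        Module.algebraMap_end_apply, sub_eq_zero] at hv
      exact hv
  have htop : ⊤ ≤ Submodule.span k S := by
    have := hK K
    rwa [h, LinearMap.ker_zero] at this
  refine ⟨_, Module.Basis.ofSpan htop, fun i => ?_⟩
  exact Module.Basis.ofSpan_subset htop ⟨i, rfl⟩

/-! ### Compositions and their partial sums -/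

namespace DescentAlgebra

variable {n : ℕ}

theorem sizeUpTo_mem_Ioo (α : Composition n) {j : ℕ} (h0 : 0 < j) (hj : j < α.length) :
    α.sizeUpTo j ∈ Finset.Ioo 0 n := by
  rw [Finset.mem_Ioo]
  constructor
  · have h := α.sizeUpTo_strict_mono (h0.trans hj)
    rw [α.sizeUpTo_zero] at h
    exact h.trans_le (α.monotone_sizeUpTo h0)
  · exact (α.sizeUpTo_strict_mono hj).trans_le (α.sizeUpTo_le _)

theorem gapsInv_subset (α : Composition n) : gapsInv α ⊆ Finset.Ioo 0 n := by
  intro i hi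
  obtain ⟨j, hj, rfl⟩ := Finset.mem_image.mp hi
  rw [Finset.mem_Ioo] at hj
  exact sizeUpTo_mem_Ioo α hj.1 hj.2

theorem mem_boundaries_iff (α : Composition n) (i : Fin (n + 1)) :
    i ∈ α.boundaries ↔ (i : ℕ) = 0 ∨ (i : ℕ) = n ∨ (i : ℕ) ∈ gapsInv α := by
  have hb : ∀ j, ((α.boundary j : Fin (n + 1)) : ℕ) = α.sizeUpTo j := fun j => rfl
  simp only [Composition.boundaries, Finset.mem_map, Finset.mem_univ, true_and, gapsInv,
    Finset.mem_image, Finset.mem_Ioo, RelEmbedding.coe_toEmbedding]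
  constructor
  · rintro ⟨j, rfl⟩
    rw [hb]
    rcases Nat.eq_zero_or_pos (j : ℕ) with h0 | h0
    · left; rw [h0, α.sizeUpTo_zero]
    · rcases Nat.lt_or_ge (j : ℕ) α.length with h | h
      · exact Or.inr (Or.inr ⟨j, ⟨h0, h⟩, rfl⟩)
      · exact Or.inr (Or.inl (α.sizeUpTo_ofLength_le _ h))
  · rintro (h | h | ⟨j, ⟨-, hj⟩, h⟩)
    · exact ⟨0, Fin.ext (by rw [hb, h]; exact α.sizeUpTo_zero)⟩
    · exact ⟨Fin.last _, Fin.ext (by rw [hb, h]; exact α.sizeUpTo_length)⟩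
    · exact ⟨⟨j, by omega⟩, Fin.ext (by rw [hb, ← h])⟩

theorem gapsInv_injective : Function.Injective (gapsInv : Composition n → Finset ℕ) := by
  intro α β h
  refine (compositionEquiv n).injective (CompositionAsSet.ext ?_)
  ext i
  change i ∈ α.boundaries ↔ i ∈ β.boundaries
  rw [mem_boundaries_iff, mem_boundaries_iff, h]

end DescentAlgebra

/-! ### Set compositions as weak orders -/

namespace SetComposition

open DescentAlgebra WeakOrder

variable {n : ℕ}

theorem exists_index (F : SetComposition n) : ∃ idx : Fin n → Fin F.blocks.length,
    ∀ a i, a ∈ F.blocks.get i ↔ idx a = i := by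
  have h : ∀ a, ∃ i, a ∈ F.blocks.get i := fun a => by
    obtain ⟨B, hB, ha⟩ := F.cover a
    obtain ⟨i, rfl⟩ := List.mem_iff_get.mp hB
    exact ⟨i, ha⟩
  choose idx hidx using h
  refine ⟨idx, fun a i => ⟨fun ha => ?_, fun e => e ▸ hidx a⟩⟩
  have hd := List.pairwise_iff_get.mp F.pairwise_disjoint
  rcases lt_trichotomy (idx a) i with h | h | h
  · exact absurd ha (Finset.disjoint_left.mp (hd _ _ h) (hidx a))
  · exact h
  · exact absurd (hidx a) (Finset.disjoint_left.mp (hd _ _ h) ha)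

/-- The position of the block containing an element. -/
noncomputable def index (F : SetComposition n) : Fin n → Fin F.blocks.length :=
  F.exists_index.choose

theorem mem_get_iff (F : SetComposition n) (a : Fin n) (i : Fin F.blocks.length) :
    a ∈ F.blocks.get i ↔ F.index a = i := F.exists_index.choose_spec a i

theorem index_surjective (F : SetComposition n) : Function.Surjective F.index := by
  intro i
  obtain ⟨a, ha⟩ := F.nonempty_of_mem _ (List.get_mem F.blocks i)
  exact ⟨a, (F.mem_get_iff a i).mp ha⟩

/-- The weak order listing the blocks from left to right. -/
noncomputable def toWeakOrder (F : SetComposition n) : WeakOrder n := ofFun F.index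

theorem toWeakOrder_le (F : SetComposition n) (a b : Fin n) :
    F.toWeakOrder.le a b ↔ F.index a ≤ F.index b := Iff.rfl

theorem length_toWeakOrder (F : SetComposition n) : F.toWeakOrder.length = F.length := by
  rw [length_eq_card_image F.toWeakOrder F.index F.toWeakOrder_le,
    Finset.image_univ_of_surjective F.index_surjective, Finset.card_univ, Fintype.card_fin, length]

theorem length_type (F : SetComposition n) : F.type.length = F.blocks.length :=
  List.length_map ..

theorem card_index_lt (F : SetComposition n) (j : ℕ) (hj : j ≤ F.blocks.length) :
    (Finset.univ.filter fun c => (F.index c : ℕ) < j).card = F.type.sizeUpTo j := by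
  induction j with
  | zero => simp
  | succ j ih =>
    have e : (Finset.univ.filter fun c => (F.index c : ℕ) < j + 1) =
        (Finset.univ.filter fun c => (F.index c : ℕ) < j) ∪ F.blocks.get ⟨j, hj⟩ := by
      ext c
      rw [Finset.mem_union, mem_get_iff, Fin.ext_iff]
      simp only [Finset.mem_filter, Finset.mem_univ, true_and]
      omega
    rw [e, Finset.card_union_of_disjoint, ih (by omega),
      F.type.sizeUpTo_succ (by rw [length_type]; exact hj)]
    · simp [type]
    · rw [Finset.disjoint_left]
      intro c hc
      rw [mem_get_iff, Fin.ext_iff]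
      exact (Finset.mem_filter.mp hc).2.ne

theorem sizes_toWeakOrder (F : SetComposition n) : F.toWeakOrder.sizes = gapsInv F.type := by
  have hrank : ∀ b, F.toWeakOrder.rank b = F.type.sizeUpTo (F.index b + 1) := by
    intro b
    rw [← card_index_lt F _ (F.index b).2, rank]
    congr 1
    ext c
    simp only [Finset.mem_filter, Finset.mem_univ, true_and, toWeakOrder_le, Fin.le_def]
    omega
  ext i
  simp only [sizes, gapsInv, Finset.mem_erase, Finset.mem_image, Finset.mem_univ, true_and,
    Finset.mem_Ioo, hrank]
  constructor
  · rintro ⟨hne, b, rfl⟩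
    refine ⟨_, ⟨Nat.succ_pos _, not_le.mp fun h => hne ?_⟩, rfl⟩
    exact F.type.sizeUpTo_ofLength_le _ h
  · rintro ⟨j, ⟨h0, hj⟩, rfl⟩
    refine ⟨(Finset.mem_Ioo.mp (sizeUpTo_mem_Ioo F.type h0 hj)).2.ne, ?_⟩
    rw [length_type] at hj
    obtain ⟨b, hb⟩ := F.index_surjective ⟨j - 1, by omega⟩
    refine ⟨b, ?_⟩
    rw [hb]
    congr 1
    simp only
    omega

theorem isContained_iff (F G : SetComposition n) :
    F.IsContained G ↔ TiesLE F.toWeakOrder G.toWeakOrder := by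
  constructor
  · intro h a b hab hba
    have e : F.index a = F.index b := le_antisymm hab hba
    obtain ⟨B, hB, hsub⟩ := h _ (List.get_mem F.blocks (F.index a))
    obtain ⟨i, rfl⟩ := List.mem_iff_get.mp hB
    have ha := (G.mem_get_iff a i).mp (hsub ((F.mem_get_iff _ _).mpr rfl))
    have hb := (G.mem_get_iff b i).mp (hsub ((F.mem_get_iff _ _).mpr e.symm))
    rw [toWeakOrder_le, ha, hb]
  · intro h A hA
    obtain ⟨i, rfl⟩ := List.mem_iff_get.mp hA
    obtain ⟨a, rfl⟩ := F.index_surjective i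
    refine ⟨_, List.get_mem G.blocks (G.index a), fun b hb => ?_⟩
    rw [mem_get_iff] at hb ⊢
    exact le_antisymm (h b a hb.le hb.ge) (h a b hb.ge hb.le)

theorem mem_blocks_iff (F : SetComposition n) (B : Finset (Fin n)) :
    B ∈ F.blocks ↔ ∃ a, ∀ b, b ∈ B ↔ F.toWeakOrder.le a b ∧ F.toWeakOrder.le b a := by
  simp only [toWeakOrder_le, ← le_antisymm_iff]
  constructor
  · intro hB
    obtain ⟨i, rfl⟩ := List.mem_iff_get.mp hB
    obtain ⟨a, rfl⟩ := F.index_surjective i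
    exact ⟨a, fun b => (F.mem_get_iff _ _).trans eq_comm⟩
  · rintro ⟨a, ha⟩
    have : B = F.blocks.get (F.index a) := by
      ext b
      rw [ha, mem_get_iff, eq_comm]
    rw [this]
    exact List.get_mem _ _

theorem toWeakOrder_injective :
    Function.Injective (toWeakOrder : SetComposition n → WeakOrder n) := by
  intro F G h
  have hpw : ∀ H : SetComposition n, H.toWeakOrder = G.toWeakOrder →
      H.blocks.Pairwise fun A B => ∀ a ∈ A, ∀ b ∈ B, ¬ G.toWeakOrder.le b a := by
    intro H hH
    refine List.pairwise_iff_get.mpr fun i j hij a ha b hb => ?_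
    rw [mem_get_iff] at ha hb
    rw [← hH, toWeakOrder_le, ha, hb]
    exact not_le.mpr hij
  -- The weak order determines the set of blocks as its tie classes, and both lists are sorted by
  -- it.
  refine SetComposition.ext (List.Perm.eq_of_pairwise ?_ (hpw F h) (hpw G rfl)
    ((List.perm_ext_iff_of_nodup F.nodup_blocks G.nodup_blocks).mpr fun B => ?_))
  · intro A B hA hB h₁ h₂
    obtain ⟨a, ha⟩ := F.nonempty_of_mem A hA
    obtain ⟨b, hb⟩ := G.nonempty_of_mem B hB
    exact absurd (G.toWeakOrder.total a b) (not_or.mpr ⟨h₂ b hb a ha, h₁ a ha b hb⟩)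
  · rw [mem_blocks_iff, mem_blocks_iff, h]

theorem toWeakOrder_surjective :
    Function.Surjective (toWeakOrder : SetComposition n → WeakOrder n) := by
  intro W
  obtain ⟨g, hg, hle⟩ := exists_surjective W
  let F : SetComposition n :=
    { blocks := List.ofFn fun j => Finset.univ.filter fun a => g a = j
      nonempty_of_mem := by
        intro B hB
        obtain ⟨j, rfl⟩ := List.mem_ofFn.mp hB
        obtain ⟨a, ha⟩ := hg j
        exact ⟨a, by simpa using ha⟩
      pairwise_disjoint := by
        refine List.pairwise_ofFn.mpr fun i j hij => Finset.disjoint_left.mpr fun a hi hj => ?_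
        rw [Finset.mem_filter] at hi hj
        exact hij.ne (hi.2.symm.trans hj.2)
      cover := fun a => ⟨_, List.mem_ofFn.mpr ⟨g a, rfl⟩, by simp⟩ }
  have hidx : ∀ a, (F.index a : ℕ) = g a := by
    intro a
    have h := (F.mem_get_iff a (F.index a)).mpr rfl
    simp only [F, List.get_ofFn, Finset.mem_filter, Finset.mem_univ, true_and] at h
    rw [h]
    rfl
  refine ⟨F, ?_⟩
  ext a b
  rw [toWeakOrder_le, hle, Fin.le_def, Fin.le_def, hidx, hidx]

theorem numFaces_toWeakOrder (α : Composition n) (F : SetComposition n) :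
    numFaces (gapsInv α) F.toWeakOrder = knapsackNumber α F := by
  classical
  rw [knapsackNumber, ← Set.ncard_image_of_injective _ toWeakOrder_injective, numFaces,
    ← Set.ncard_coe_finset]
  congr 1
  ext W
  obtain ⟨G, rfl⟩ := toWeakOrder_surjective W
  rw [toWeakOrder_injective.mem_set_image]
  simp [isContained_iff, sizes_toWeakOrder, gapsInv_injective.eq_iff, and_comm]

theorem signedKnapsackSet_eq (α : Composition n) :
    signedKnapsackSet α = Finset.univ.image fun G : WeakOrder n =>
      (-1 : ℤ) ^ (n - G.length) * (numFaces (gapsInv α) G : ℤ) := by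
  classical
  rw [← Finset.image_univ_of_surjective toWeakOrder_surjective, Finset.image_image,
    signedKnapsackSet]
  refine Finset.image_congr fun F _ => ?_
  rw [Function.comp_apply, length_toWeakOrder, numFaces_toWeakOrder, signedKnapsackNumber]

end SetComposition

/-! ### Transfer to multiplication operators and to the swapped product -/

theorem aeval_mulLeft_eq_zero {k A : Type*} [Field k] [Ring A] [Algebra k A] {x : A} {p : k[X]}
    (h : aeval x p = 0) : aeval (LinearMap.mulLeft k x) p = 0 := by
  have := aeval_algHom_apply (Algebra.lmul k A) x p
  rw [h, map_zero] at this
  exact this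

theorem aeval_mulRight_eq_zero {k A : Type*} [Field k] [Ring A] [Algebra k A] {x : A} {p : k[X]}
    (h : aeval x p = 0) : aeval (LinearMap.mulRight k x) p = 0 := by
  have e : ∀ p : k[X], aeval (LinearMap.mulRight k x) p = LinearMap.mulRight k (aeval x p) := by
    intro p
    induction p using Polynomial.induction_on with
    | C a => ext y; simp [Algebra.smul_def, Algebra.commutes]
    | add p q hp hq => rw [map_add, map_add, hp, hq]; ext y; simp [mul_add]
    | monomial m a hp =>
      have hx : aeval x (C a * X ^ (m + 1)) = x * aeval x (C a * X ^ m) := by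
        rw [pow_succ, ← mul_assoc, mul_comm (C a * X ^ m) X, map_mul, aeval_X]
      rw [hx, pow_succ, ← mul_assoc, map_mul, hp, aeval_X]
      ext y
      simp [mul_assoc]
  rw [e, h]
  ext y
  simp

/-- The involution `u` conjugates `u * x` into `x * u`. -/
theorem aeval_swap_eq_zero {k A : Type*} [Field k] [Ring A] [Algebra k A] {u x : A} {p : k[X]}
    (hu : u * u = 1) (h : aeval (u * x) p = 0) : aeval (x * u) p = 0 := by
  have e : ∀ p : k[X], u * aeval (x * u) p = aeval (u * x) p * u := by
    intro p
    induction p using Polynomial.induction_on with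
    | C a => simp [Algebra.commutes]
    | add p q hp hq => rw [map_add, map_add, mul_add, add_mul, hp, hq]
    | monomial m a hp =>
      rw [pow_succ, ← mul_assoc, map_mul, map_mul (aeval (u * x)) _ X, aeval_X, aeval_X,
        ← mul_assoc, hp]
      simp only [mul_assoc]
  have := congrArg (u * ·) (e p)
  simpa [← mul_assoc, hu, h] using this

theorem mainTheorem2 {k : Type*} [Field k] [CharZero k] (n : ℕ) (α : Composition n) :
    minpoly k (DescentAlgebra.w₀ k n * DescentAlgebra.B k α) =
        ∏ z ∈ SetComposition.signedKnapsackSet α, (X - C (z : k)) ∧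
      (IsDiagonalizable (LinearMap.mulLeft k (DescentAlgebra.w₀ k n * DescentAlgebra.B k α)) ∧
        IsDiagonalizable (LinearMap.mulRight k (DescentAlgebra.w₀ k n * DescentAlgebra.B k α))) ∧
      (IsDiagonalizable (LinearMap.mulLeft k (DescentAlgebra.B k α * DescentAlgebra.w₀ k n)) ∧
        IsDiagonalizable (LinearMap.mulRight k (DescentAlgebra.B k α * DescentAlgebra.w₀ k n))) := by
  classical
  have hmin : minpoly k (DescentAlgebra.w₀ k n * DescentAlgebra.B k α) =
      ∏ z ∈ SetComposition.signedKnapsackSet α, (X - C (z : k)) := by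
    rw [SetComposition.signedKnapsackSet_eq]
    exact WeakOrder.minpoly_w₀_mul_BSet k (DescentAlgebra.gapsInv_subset α)
  have hroot := minpoly.aeval k (DescentAlgebra.w₀ k n * DescentAlgebra.B k α)
  rw [hmin, ← Finset.prod_image (s := SetComposition.signedKnapsackSet α)
    (g := fun z : ℤ => (z : k)) (f := fun c => X - C c) fun a _ b _ h => Int.cast_injective h]
    at hroot
  have hroot' := aeval_swap_eq_zero (WeakOrder.w₀_mul_w₀ k) hroot
  exact ⟨hmin, ⟨isDiagonalizable_of_aeval_prod_eq_zero _ _ (aeval_mulLeft_eq_zero hroot),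
    isDiagonalizable_of_aeval_prod_eq_zero _ _ (aeval_mulRight_eq_zero hroot)⟩,
    isDiagonalizable_of_aeval_prod_eq_zero _ _ (aeval_mulLeft_eq_zero hroot'),
    isDiagonalizable_of_aeval_prod_eq_zero _ _ (aeval_mulRight_eq_zero hroot')⟩
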